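/- Let $\mathcal H$ be a complex Hilbert space and let $T:\operatorname{dom}T\subseteq\mathcal H\to\mathcal H$ be a closed, possibly unbounded, linear operator: $\operatorname{dom}T$ is a linear subspace (not necessarily dense or closed), $T$ is linear, and its graph is closed in $\mathcal H\times\mathcal H$. Let $\hat{\mathbb C}=\mathbb C\cup\{\infty\}$ be the extended complex plane with its usual (chordal metric) topology. The scaled relative graph of $T$ is $$\operatorname{SRG}(T)=\Big\{\tfrac{\|Tu\|}{\|u\|}\,e^{\pm i\angle(u,Tu)} : u\in\operatorname{dom}T,\ u\neq0\Big\}\subseteq\hat{\mathbb C},$$ where $\angle(u,y)\in[0,\pi]$ is given by $\cos\angle(u,y)=\dfrac{\operatorname{Re}\langle y,u\rangle}{\|y\|\,\|u\|}$ for $y\ne0$ and $\angle(u,0)=0$. For a linear operator $S:\operatorname{dom}S\subseteq\mathcal H\to\mathcal H$ put $$\operatorname{maxgain}(S)=\sup_{u\in\operatorname{dom}S,\,u\ne0}\frac{\|Su\|}{\|u\|},\qquad \operatorname{mingain}(S)=\inf_{u\in\operatorname{dom}S,\,u\ne0}\frac{\|Su\|}{\|u\|},$$ as elements of $[0,\infty]$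 (so that $\sup\emptyset=0$ and $\inf\emptyset=\infty$). For $\alpha\in\mathbb R$ let $$\operatorname{Ann}(T,\alpha)=\{\alpha+z : z\in\hat{\mathbb C},\ \operatorname{mingain}(T-\alpha I)\le|z|\le\operatorname{maxgain}(T-\alpha I)\}\subseteq\hat{\mathbb C},$$ where $T-\alpha I$ has domain $\operatorname{dom}T$, and $|\infty|=\infty$, $\alpha+\infty=\infty$; thus $\infty\in\operatorname{Ann}(T,\alpha)$ if and only if $\operatorname{maxgain}(T-\alpha I)=\infty$. Then $$\overline{\operatorname{SRG}(T)}=\bigcap_{\alpha\in\mathbb R}\operatorname{Ann}(T,\alpha),$$ where the closure is taken in $\hat{\mathbb C}$. -/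

import Mathlib

open scoped ENNReal

noncomputable section

namespace ScaledRelativeGraph

variable {H : Type*} [NormedAddCommGroup H] [InnerProductSpace ℂ H]

/-- The angle `∠(u, y) ∈ [0, π]` between two vectors of a complex Hilbert space, determined by
`cos ∠(u, y) = Re ⟨y, u⟩ / (‖y‖ ‖u‖)`, with the convention `∠(u, 0) = 0`. -/
def angle (u y : H) : ℝ :=
  open Classical in
  if y = 0 then 0 else Real.arccos ((inner ℂ y u).re / (‖y‖ * ‖u‖))

/-- The scaled relative graph of a (possibly unbounded) linear operator `T : dom T ⊆ H → H`,
a subset of the extended complex plane `OnePoint ℂ = ℂ ∪ {∞}`. -/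
def srg (T : H →ₗ.[ℂ] H) : Set (OnePoint ℂ) :=
  {w | ∃ u : T.domain, u ≠ 0 ∧
    (w = (((‖T u‖ / ‖(u : H)‖ : ℝ) * Complex.exp (Complex.I * (angle (u : H) (T u) : ℝ)) : ℂ) :
        OnePoint ℂ) ∨
     w = (((‖T u‖ / ‖(u : H)‖ : ℝ) * Complex.exp (-(Complex.I * (angle (u : H) (T u) : ℝ))) : ℂ) :
        OnePoint ℂ))}

/-- The operator `T - α I`, with the same domain as `T`. -/
def subScalar (T : H →ₗ.[ℂ] H) (α : ℝ) : H →ₗ.[ℂ] H where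
  domain := T.domain
  toFun := T.toFun - (α : ℂ) • T.domain.subtype

/-- The maximum gain `sup {‖T u‖ / ‖u‖ : u ∈ dom T, u ≠ 0}`, a value in `[0, ∞]`. -/
def maxGain (T : H →ₗ.[ℂ] H) : ℝ≥0∞ :=
  ⨆ (u : T.domain) (_ : u ≠ 0), ENNReal.ofReal (‖T u‖ / ‖(u : H)‖)

/-- The minimum gain `inf {‖T u‖ / ‖u‖ : u ∈ dom T, u ≠ 0}`, a value in `[0, ∞]`. -/
def minGain (T : H →ₗ.[ℂ] H) : ℝ≥0∞ :=
  ⨅ (u : T.domain) (_ : u ≠ 0), ENNReal.ofReal (‖T u‖ / ‖(u : H)‖)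

/-- The modulus on the extended complex plane, with `|∞| = ∞`. -/
def extAbs (z : OnePoint ℂ) : ℝ≥0∞ :=
  z.elim ⊤ (fun x : ℂ => ENNReal.ofReal ‖x‖)

/-- The translation `z ↦ α + z` of the extended complex plane, with `α + ∞ = ∞`. -/
def extTranslate (α : ℝ) (z : OnePoint ℂ) : OnePoint ℂ :=
  OnePoint.map (fun x : ℂ => (α : ℂ) + x) z

/-- The annulus `{α + z : minGain (T - α I) ≤ |z| ≤ maxGain (T - α I)}` in the extended complex
plane. It contains `∞` exactly when `maxGain (T - α I) = ∞`. -/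
def annulus (T : H →ₗ.[ℂ] H) (α : ℝ) : Set (OnePoint ℂ) :=
  extTranslate α ''
    {z | minGain (subScalar T α) ≤ extAbs z ∧ extAbs z ≤ maxGain (subScalar T α)}

end ScaledRelativeGraph

end

/-!
A complex number `z` is determined up to conjugation by the pair `(Re z, |z|²)`, and both sides of
the claimed identity are invariant under conjugation, so everything is read off from such pairs.
In these coordinates the scaled relative graph of `T` becomes the set
`{(Re ⟨u, T u⟩ / ‖u‖², ‖T u‖² / ‖u‖²) : u ≠ 0}`, called `profile T` below. It is a joint numerical
range of two quadratic forms on `dom T`, hence convex by the Toeplitz–Hausdorff theorem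
(`convex_jointRange`).

Since `|z - α|² = |z|² - 2 α Re z + α²`, and likewise for `‖T u - α u‖² / ‖u‖²`, the finite points
of `annulus T α` are those `z` for which `(Re z, |z|²)` lies in the smallest closed strip or half
plane with normal `(-2 α, 1)` that contains the profile. A point in all the annuli but outside the
closure of the profile would be separated from it by a line. A line that is not vertical has a
normal `(-2 α, 1)`, which is excluded; a vertical one can be tilted slightly, because the profile
lies in the upper half plane (`mem_closure_profile`). The square root
`(x, w) ↦ x ± i √(w - x²)` is continuous and carries this back to `ℂ`. The point `∞` lies in either
side exactly when `T` is unbounded, and the reverse inclusion holds because each annulus is a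
closed set that contains the scaled relative graph.
-/

namespace ScaledRelativeGraph

/-! ### The Toeplitz–Hausdorff theorem for sesquilinear forms -/

/-- The quadratic form of a sesquilinear form along a segment: its cross term is the real part of
a complex number, which the phase `c` rotates. -/
lemma re_form_segment {V : Type*} [AddCommGroup V] [Module ℂ V] (φ : V →ₗ⋆[ℂ] V →ₗ[ℂ] ℂ)
    (u v : V) (s t : ℝ) {c : ℂ} (hc : ‖c‖ = 1) :
    (φ ((s : ℂ) • u + (t : ℂ) • c • v) ((s : ℂ) • u + (t : ℂ) • c • v)).re =
      s ^ 2 * (φ u u).re + t ^ 2 * (φ v v).re +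
        s * t * (c * (φ u v + (starRingEnd ℂ) (φ v u))).re := by
  have h : c.re * c.re + c.im * c.im = 1 := by
    rw [← Complex.normSq_apply, Complex.normSq_eq_norm_sq, hc, one_pow]
  simp only [map_add, LinearMap.add_apply, LinearMap.map_smulₛₗ, LinearMap.smul_apply,
    map_smul, smul_eq_mul, Complex.conj_ofReal, Complex.add_re, Complex.mul_re, Complex.mul_im,
    Complex.ofReal_re, Complex.ofReal_im, Complex.conj_re, Complex.conj_im, Complex.add_im]
  linear_combination t ^ 2 * (φ v v).re * h

lemma exists_norm_one_re_mul_eq_zero (q : ℂ) : ∃ c : ℂ, ‖c‖ = 1 ∧ (c * q).re = 0 := by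
  by_cases hq : q = 0
  · exact ⟨1, by simp, by simp [hq]⟩
  · have hn : (‖q‖ : ℂ) ≠ 0 := by simpa using hq
    refine ⟨Complex.I * (starRingEnd ℂ) q / ‖q‖, by simp [hq], ?_⟩
    have : Complex.I * (starRingEnd ℂ) q / ‖q‖ * q = (‖q‖ : ℂ) * Complex.I := by
      field_simp
      rw [← Complex.normSq_eq_conj_mul_self, Complex.normSq_eq_norm_sq]
      push_cast
      rfl
    simp [this]

/-- A Toeplitz–Hausdorff theorem: the joint range of two quadratic forms on a complex vector space,
normalized by a positive definite one, is convex. -/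
theorem convex_jointRange {V : Type*} [AddCommGroup V] [Module ℂ V]
    (φ ψ ν : V →ₗ⋆[ℂ] V →ₗ[ℂ] ℂ) (hν : ∀ u, u ≠ 0 → 0 < (ν u u).re) :
    Convex ℝ {p : ℝ × ℝ | ∃ u : V, u ≠ 0 ∧
      p = ((φ u u).re / (ν u u).re, (ψ u u).re / (ν u u).re)} := by
  rintro p ⟨u, hu, hp⟩ q ⟨v, hv, hq⟩ a b ha hb hab
  rcases eq_or_ne p q with rfl | hpq
  · rw [← add_smul, hab, one_smul]
    exact ⟨u, hu, hp⟩
  obtain ⟨p₁, p₂⟩ := p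
  obtain ⟨q₁, q₂⟩ := q
  have hNu := hν u hu
  have hNv := hν v hv
  rw [Prod.mk.injEq, eq_div_iff hNu.ne', eq_div_iff hNu.ne'] at hp
  rw [Prod.mk.injEq, eq_div_iff hNv.ne', eq_div_iff hNv.ne'] at hq
  set d₁ := q₁ - p₁ with hd₁
  set d₂ := q₂ - p₂ with hd₂
  have hd : 0 < d₁ ^ 2 + d₂ ^ 2 := by
    by_contra h
    have h₁ : d₁ = 0 := by nlinarith [sq_nonneg d₁, sq_nonneg d₂]
    have h₂ : d₂ = 0 := by nlinarith [sq_nonneg d₁, sq_nonneg d₂]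
    exact hpq (Prod.ext (by simp only; linarith) (by simp only; linarith))
  -- The form `χ` vanishes where the value is on the line through `p` and `q`; it does so at both
  -- ends of the segment, and by choice of the phase `c` on the whole segment.
  let χ : V →ₗ⋆[ℂ] V →ₗ[ℂ] ℂ := (d₂ : ℂ) • (φ - (p₁ : ℂ) • ν) - (d₁ : ℂ) • (ψ - (p₂ : ℂ) • ν)
  have hχ (w : V) : (χ w w).re = d₂ * ((φ w w).re - p₁ * (ν w w).re)
      - d₁ * ((ψ w w).re - p₂ * (ν w w).re) := by
    simp [χ]
  -- The form `δ` measures the position along that line.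
  let δ : V →ₗ⋆[ℂ] V →ₗ[ℂ] ℂ := (d₁ : ℂ) • (φ - (p₁ : ℂ) • ν) + (d₂ : ℂ) • (ψ - (p₂ : ℂ) • ν)
  have hδ (w : V) : (δ w w).re = d₁ * ((φ w w).re - p₁ * (ν w w).re)
      + d₂ * ((ψ w w).re - p₂ * (ν w w).re) := by
    simp [δ]
  have hχu : (χ u u).re = 0 := by rw [hχ, ← hp.1, ← hp.2]; ring
  have hχv : (χ v v).re = 0 := by rw [hχ, ← hq.1, ← hq.2, hd₁, hd₂]; ring
  have hδu : (δ u u).re = 0 := by rw [hδ, ← hp.1, ← hp.2]; ring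
  have hδv : (δ v v).re = (d₁ ^ 2 + d₂ ^ 2) * (ν v v).re := by
    rw [hδ, ← hq.1, ← hq.2, hd₁, hd₂]; ring
  obtain ⟨c, hc, hc0⟩ := exists_norm_one_re_mul_eq_zero (χ u v + (starRingEnd ℂ) (χ v u))
  let γ : ℝ → V := fun s => ((1 - s : ℝ) : ℂ) • u + (s : ℂ) • c • v
  have hχγ (s : ℝ) : (χ (γ s) (γ s)).re = 0 := by
    rw [re_form_segment χ u v _ _ hc, hχu, hχv, hc0]; ring
  let g : ℝ → ℝ := fun s => (δ (γ s) (γ s)).re - b * (d₁ ^ 2 + d₂ ^ 2) * (ν (γ s) (γ s)).re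
  have hg : Continuous g := by
    simp only [g, γ, re_form_segment δ u v _ _ hc, re_form_segment ν u v _ _ hc]
    fun_prop
  have hg0 : g 0 ≤ 0 := by
    have : g 0 = -(b * (d₁ ^ 2 + d₂ ^ 2) * (ν u u).re) := by simp [g, γ, hδu]
    rw [this]
    have := mul_nonneg (mul_nonneg hb hd.le) hNu.le
    linarith
  have hg1 : 0 ≤ g 1 := by
    have : g 1 = a * (d₁ ^ 2 + d₂ ^ 2) * (ν v v).re := by
      simp only [g, γ, re_form_segment δ u v _ _ hc, re_form_segment ν u v _ _ hc, hδv]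
      linear_combination -(d₁ ^ 2 + d₂ ^ 2) * (ν v v).re * hab
    rw [this]
    positivity
  obtain ⟨s, -, hs⟩ := intermediate_value_Icc (zero_le_one' ℝ) hg.continuousOn ⟨hg0, hg1⟩
  have hγ : γ s ≠ 0 := by
    intro h0
    have e : ((1 - s : ℝ) : ℂ) • u = -((s : ℂ) • c • v) := eq_neg_of_add_eq_zero_left h0
    have e' := congrArg (fun w => (δ w w).re) e
    have h₁ := re_form_segment δ u v (1 - s) 0 hc
    have h₂ := re_form_segment δ u v 0 s hc
    simp only [map_neg, LinearMap.neg_apply, neg_neg] at e'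
    simp only [Complex.ofReal_zero, zero_smul, add_zero] at h₁
    simp only [Complex.ofReal_zero, zero_smul, zero_add] at h₂
    rw [h₁, h₂, hδu, hδv] at e'
    have hs0 : s = 0 := by
      have : s ^ 2 * ((d₁ ^ 2 + d₂ ^ 2) * (ν v v).re) = 0 := by linarith
      simpa [hd.ne', hNv.ne'] using this
    exact hu (by simpa [γ, hs0] using h0)
  have hN := hν _ hγ
  have h₁ := hχγ s
  have h₂ : (δ (γ s) (γ s)).re = b * (d₁ ^ 2 + d₂ ^ 2) * (ν (γ s) (γ s)).re := sub_eq_zero.mp hs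
  rw [hχ] at h₁
  rw [hδ] at h₂
  -- `χ = 0` and `δ = b |d|² ν` form a linear system with determinant `|d|²`.
  refine ⟨γ s, hγ, Prod.ext ?_ ?_⟩
  · simp only [Prod.fst_add, Prod.smul_fst, smul_eq_mul]
    rw [eq_div_iff hN.ne']
    refine mul_left_cancel₀ hd.ne' ?_
    obtain rfl : a = 1 - b := by linarith
    linear_combination -d₂ * h₁ - d₁ * h₂ - (d₁ ^ 2 + d₂ ^ 2) * b * (ν (γ s) (γ s)).re * hd₁
  · simp only [Prod.snd_add, Prod.smul_snd, smul_eq_mul]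
    rw [eq_div_iff hN.ne']
    refine mul_left_cancel₀ hd.ne' ?_
    obtain rfl : a = 1 - b := by linarith
    linear_combination d₁ * h₁ - d₂ * h₂ - (d₁ ^ 2 + d₂ ^ 2) * b * (ν (γ s) (γ s)).re * hd₂

/-! ### The profile of an operator -/

variable {H : Type*} [NormedAddCommGroup H] [InnerProductSpace ℂ H]

/-- The scaled relative graph in the coordinates `(Re z, |z|²)`: the joint range of the Rayleigh
quotients `Re ⟨u, T u⟩ / ‖u‖²` and `‖T u‖² / ‖u‖²`. -/
def profile (T : H →ₗ.[ℂ] H) : Set (ℝ × ℝ) :=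
  {p | ∃ u : T.domain, u ≠ 0 ∧
    p = ((inner ℂ (u : H) (T u)).re / ‖(u : H)‖ ^ 2, ‖T u‖ ^ 2 / ‖(u : H)‖ ^ 2)}

lemma norm_coe_pos {T : H →ₗ.[ℂ] H} {u : T.domain} (hu : u ≠ 0) : 0 < ‖(u : H)‖ := by
  simpa using hu

lemma convex_profile (T : H →ₗ.[ℂ] H) : Convex ℝ (profile T) := by
  let i : T.domain →ₗ[ℂ] H := T.domain.subtype
  have hsq (x : H) : (inner ℂ x x).re = ‖x‖ ^ 2 := inner_self_eq_norm_sq (𝕜 := ℂ) x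
  have h := convex_jointRange (((innerₛₗ ℂ).comp i).compl₂ T.toFun)
    (((innerₛₗ ℂ).comp T.toFun).compl₂ T.toFun) (((innerₛₗ ℂ).comp i).compl₂ i) fun u hu => by
      simp only [LinearMap.compl₂_apply, LinearMap.comp_apply, coe_innerₛₗ_apply, hsq]
      exact pow_pos (norm_coe_pos hu) 2
  simp only [LinearMap.compl₂_apply, LinearMap.comp_apply, coe_innerₛₗ_apply, hsq] at h
  exact h

/-- The profile lies above the parabola `w = x²`, by the Cauchy–Schwarz inequality. -/
lemma sq_fst_le_snd {T : H →ₗ.[ℂ] H} {p : ℝ × ℝ} (hp : p ∈ profile T) : p.1 ^ 2 ≤ p.2 := by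
  obtain ⟨u, hu, rfl⟩ := hp
  have hn := norm_coe_pos hu
  have h : |(inner ℂ (u : H) (T u)).re| ≤ ‖(u : H)‖ * ‖T u‖ :=
    (Complex.abs_re_le_norm _).trans (norm_inner_le_norm _ _)
  have h' := pow_le_pow_left₀ (abs_nonneg _) h 2
  rw [sq_abs] at h'
  simp only
  rw [div_pow, div_le_div_iff₀ (by positivity) (by positivity)]
  nlinarith [mul_le_mul_of_nonneg_right h' (sq_nonneg ‖(u : H)‖)]

lemma eq_mul_exp_or_iff (z : ℂ) (r θ : ℝ) :
    (z = r * Complex.exp (Complex.I * θ) ∨ z = r * Complex.exp (-(Complex.I * θ))) ↔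
      z.re = r * Real.cos θ ∧ ‖z‖ ^ 2 = r ^ 2 := by
  have e₁ : (r : ℂ) * Complex.exp (Complex.I * θ) = ⟨r * Real.cos θ, r * Real.sin θ⟩ := by
    rw [mul_comm Complex.I]
    apply Complex.ext <;> simp [Complex.exp_ofReal_mul_I_re, Complex.exp_ofReal_mul_I_im]
  have e₂ : (r : ℂ) * Complex.exp (-(Complex.I * θ)) = ⟨r * Real.cos θ, -(r * Real.sin θ)⟩ := by
    rw [mul_comm Complex.I, ← neg_mul, ← Complex.ofReal_neg]
    apply Complex.ext <;> rw [Complex.exp_mul_I] <;>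
      simp [Complex.cos_ofReal_re, Complex.sin_ofReal_re]
  rw [e₁, e₂, Complex.ext_iff, Complex.ext_iff, Complex.sq_norm, Complex.normSq_apply]
  simp only
  rw [← and_or_left, ← sq_eq_sq_iff_eq_or_eq_neg]
  refine and_congr_right fun h => ?_
  rw [h]
  have := Real.sin_sq_add_cos_sq θ
  constructor <;> intro h'
  · linear_combination h' + r ^ 2 * this
  · linear_combination h' - r ^ 2 * this

/-- `(‖T u‖ / ‖u‖) cos ∠(u, T u)` is the Rayleigh quotient, also where `T u = 0`. -/
lemma gain_mul_cos_angle (T : H →ₗ.[ℂ] H) (u : T.domain) :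
    ‖T u‖ / ‖(u : H)‖ * Real.cos (angle (u : H) (T u)) =
      (inner ℂ (u : H) (T u)).re / ‖(u : H)‖ ^ 2 := by
  unfold angle
  split_ifs with h
  · simp [h]
  · rcases eq_or_ne (u : H) 0 with hu | hu
    · simp [hu]
    have hn : ‖(u : H)‖ ≠ 0 := norm_ne_zero_iff.mpr hu
    have hm : ‖T u‖ ≠ 0 := norm_ne_zero_iff.mpr h
    have hb : |(inner ℂ (T u) (u : H)).re / (‖T u‖ * ‖(u : H)‖)| ≤ 1 := by
      rw [abs_div, abs_of_nonneg (by positivity : 0 ≤ ‖T u‖ * ‖(u : H)‖)]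
      exact div_le_one_of_le₀ ((Complex.abs_re_le_norm _).trans (norm_inner_le_norm _ _))
        (by positivity)
    rw [Real.cos_arccos (abs_le.mp hb).1 (abs_le.mp hb).2]
    have hsymm : (inner ℂ (T u) (u : H)).re = (inner ℂ (u : H) (T u)).re :=
      inner_re_symm (𝕜 := ℂ) _ _
    rw [hsymm]
    field_simp

/-- A complex number lies in the scaled relative graph exactly when its coordinates lie in the
profile. -/
lemma coe_mem_srg_iff (T : H →ₗ.[ℂ] H) (z : ℂ) :
    (z : OnePoint ℂ) ∈ srg T ↔ (z.re, ‖z‖ ^ 2) ∈ profile T := by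
  simp only [srg, profile, Set.mem_ofPred_eq, OnePoint.coe_eq_coe]
  refine exists_congr fun u => and_congr_right fun _ => ?_
  rw [eq_mul_exp_or_iff, gain_mul_cos_angle, Prod.mk.injEq, div_pow]

lemma infty_notMem_srg (T : H →ₗ.[ℂ] H) : (OnePoint.infty : OnePoint ℂ) ∉ srg T := by
  rintro ⟨u, -, h | h⟩ <;> exact OnePoint.infty_ne_coe _ h

/-- Closure points of the profile lift to closure points of the scaled relative graph, along the
continuous square root `(x, w) ↦ x ± i √(w - x²)`. -/
lemma coe_mem_closure_srg {T : H →ₗ.[ℂ] H} {z : ℂ} (hz : (z.re, ‖z‖ ^ 2) ∈ closure (profile T)) :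
    (z : OnePoint ℂ) ∈ closure (srg T) := by
  obtain ⟨σ, hσ, hσz⟩ : ∃ σ : ℝ, σ ^ 2 = 1 ∧ z.im = σ * |z.im| := by
    rcases abs_choice z.im with h | h
    · exact ⟨1, by norm_num, by rw [h]; ring⟩
    · exact ⟨-1, by norm_num, by rw [h]; ring⟩
  let g : ℝ × ℝ → ℂ := fun p => (p.1 : ℂ) + ((σ * √(p.2 - p.1 ^ 2) : ℝ) : ℂ) * Complex.I
  have hg : Continuous fun p => (g p : OnePoint ℂ) :=
    OnePoint.continuous_coe.comp (by fun_prop)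
  have hgz : g (z.re, ‖z‖ ^ 2) = z := by
    have : ‖z‖ ^ 2 - z.re ^ 2 = z.im ^ 2 := by
      rw [Complex.sq_norm, Complex.normSq_apply]; ring
    simp only [g, this, Real.sqrt_sq_eq_abs, ← hσz]
    exact Complex.re_add_im z
  have hmaps : Set.MapsTo (fun p => (g p : OnePoint ℂ)) (profile T) (srg T) := by
    intro p hp
    rw [coe_mem_srg_iff]
    have h₁ : (g p).re = p.1 := by simp [g]
    have h₂ : (g p).im = σ * √(p.2 - p.1 ^ 2) := by simp [g]
    have h₃ : ‖g p‖ ^ 2 = p.2 := by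
      rw [Complex.sq_norm, Complex.normSq_apply, h₁, h₂]
      have := Real.sq_sqrt (sub_nonneg.mpr (sq_fst_le_snd hp))
      linear_combination σ ^ 2 * this + (p.2 - p.1 ^ 2) * hσ
    rwa [h₁, h₃]
  simpa only [hgz] using map_mem_closure hg hz hmaps

/-! ### Annuli in terms of the profile -/

lemma coe_mem_annulus_iff (T : H →ₗ.[ℂ] H) (α : ℝ) (z : ℂ) :
    (z : OnePoint ℂ) ∈ annulus T α ↔
      minGain (subScalar T α) ≤ ENNReal.ofReal ‖z - α‖ ∧
        ENNReal.ofReal ‖z - α‖ ≤ maxGain (subScalar T α) := by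
  constructor
  · rintro ⟨w, hw, he⟩
    induction w with
    | infty => exact absurd he (OnePoint.infty_ne_coe z)
    | coe w =>
      have : (α : ℂ) + w = z := OnePoint.coe_injective he
      rw [← this, add_sub_cancel_left]
      exact hw
  · intro h
    exact ⟨((z - α : ℂ) : OnePoint ℂ), h, by simp [extTranslate]⟩

lemma infty_mem_annulus_iff (T : H →ₗ.[ℂ] H) (α : ℝ) :
    OnePoint.infty ∈ annulus T α ↔ maxGain (subScalar T α) = ⊤ := by
  constructor
  · rintro ⟨w, hw, he⟩
    induction w with
    | infty => exact top_le_iff.mp hw.2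
    | coe w => exact absurd he (OnePoint.coe_ne_infty _)
  · intro h
    exact ⟨OnePoint.infty, ⟨le_top, h.ge⟩, rfl⟩

lemma continuous_extAbs : Continuous extAbs := by
  rw [OnePoint.continuous_iff]
  refine ⟨?_, ENNReal.continuous_ofReal.comp continuous_norm⟩
  rw [Filter.coclosedCompact_eq_cocompact]
  exact ENNReal.tendsto_ofReal_atTop.comp tendsto_norm_cocompact_atTop

lemma isClosed_annulus (T : H →ₗ.[ℂ] H) (α : ℝ) : IsClosed (annulus T α) :=
  (Homeomorph.onePointCongr (Homeomorph.addLeft (α : ℂ))).isClosedMap _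
    ((isClosed_le continuous_const continuous_extAbs).inter
      (isClosed_le continuous_extAbs continuous_const))

lemma norm_sub_ofReal_sq (z : ℂ) (α : ℝ) :
    ‖z - α‖ ^ 2 = ‖z‖ ^ 2 - 2 * α * z.re + α ^ 2 := by
  simp only [Complex.sq_norm, Complex.normSq_apply, Complex.sub_re, Complex.sub_im,
    Complex.ofReal_re, Complex.ofReal_im]
  ring

lemma gain_subScalar_sq (T : H →ₗ.[ℂ] H) (α : ℝ) {u : T.domain} (hu : u ≠ 0) :
    (‖subScalar T α u‖ / ‖(u : H)‖) ^ 2 =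
      ‖T u‖ ^ 2 / ‖(u : H)‖ ^ 2 - 2 * α * ((inner ℂ (u : H) (T u)).re / ‖(u : H)‖ ^ 2)
        + α ^ 2 := by
  have hn := (norm_coe_pos hu).ne'
  have h : ‖subScalar T α u‖ ^ 2 =
      ‖T u‖ ^ 2 - 2 * α * (inner ℂ (u : H) (T u)).re + α ^ 2 * ‖(u : H)‖ ^ 2 := by
    have e : subScalar T α u = T u - (α : ℂ) • (u : H) := rfl
    have hsymm : (inner ℂ (T u) (u : H)).re = (inner ℂ (u : H) (T u)).re :=
      inner_re_symm (𝕜 := ℂ) _ _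
    rw [e, norm_sub_sq (𝕜 := ℂ), inner_smul_right, norm_smul, mul_pow]
    simp [hsymm]
    ring
  rw [div_pow, h]
  field_simp

lemma srg_subset_annulus (T : H →ₗ.[ℂ] H) (α : ℝ) : srg T ⊆ annulus T α := by
  intro w hw
  induction w with
  | infty => exact absurd hw (infty_notMem_srg T)
  | coe z =>
    obtain ⟨u, hu, he⟩ := (coe_mem_srg_iff T z).mp hw
    obtain ⟨h₁, h₂⟩ := Prod.mk.inj he
    have h : ‖z - α‖ = ‖subScalar T α u‖ / ‖(u : H)‖ := by
      rw [← sq_eq_sq₀ (norm_nonneg _) (by positivity), gain_subScalar_sq T α hu,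
        norm_sub_ofReal_sq, h₁, h₂]
    rw [coe_mem_annulus_iff, h]
    exact ⟨iInf₂_le (α := ENNReal) u hu,
      le_iSup₂ (α := ENNReal) (f := fun (u : (subScalar T α).domain) (_ : u ≠ 0) =>
        ENNReal.ofReal (‖subScalar T α u‖ / ‖(u : H)‖)) u hu⟩

/-- A lower bound of the profile in the direction `(-2 α, 1)` holds at the points of the annulus. -/
lemma le_of_mem_annulus {T : H →ₗ.[ℂ] H} {α m : ℝ} {z : ℂ} (hz : (z : OnePoint ℂ) ∈ annulus T α)
    (h : ∀ p ∈ profile T, m ≤ p.2 - 2 * α * p.1) : m ≤ ‖z‖ ^ 2 - 2 * α * z.re := by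
  have hle : ENNReal.ofReal √(m + α ^ 2) ≤ minGain (subScalar T α) := by
    refine le_iInf₂ fun u hu => ENNReal.ofReal_le_ofReal ?_
    refine Real.sqrt_le_iff.mpr ⟨by positivity, ?_⟩
    rw [gain_subScalar_sq T α hu]
    have := h _ ⟨u, hu, rfl⟩
    simp only at this
    linarith
  have := (ENNReal.ofReal_le_ofReal_iff (norm_nonneg _)).mp
    (hle.trans ((coe_mem_annulus_iff T α z).mp hz).1)
  have := (Real.sqrt_le_iff.mp this).2
  rw [norm_sub_ofReal_sq] at this
  linarith

/-- An upper bound of the profile in the direction `(-2 α, 1)` holds at the points of the annulus.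
A point of the profile shows that `m + α²` is nonnegative, so that its square root bounds the
gains. -/
lemma le_of_mem_annulus' {T : H →ₗ.[ℂ] H} {α m : ℝ} {z : ℂ} (hz : (z : OnePoint ℂ) ∈ annulus T α)
    (hne : (profile T).Nonempty) (h : ∀ p ∈ profile T, p.2 - 2 * α * p.1 ≤ m) :
    ‖z‖ ^ 2 - 2 * α * z.re ≤ m := by
  have hm : 0 ≤ m + α ^ 2 := by
    obtain ⟨p, hp⟩ := hne
    nlinarith [h p hp, sq_fst_le_snd hp, sq_nonneg (p.1 - α)]
  have hle : maxGain (subScalar T α) ≤ ENNReal.ofReal √(m + α ^ 2) := by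
    refine iSup₂_le fun u hu => ENNReal.ofReal_le_ofReal ?_
    refine Real.le_sqrt_of_sq_le ?_
    rw [gain_subScalar_sq T α hu]
    have := h _ ⟨u, hu, rfl⟩
    simp only at this
    linarith
  have := (ENNReal.ofReal_le_ofReal_iff (Real.sqrt_nonneg _)).mp
    (((coe_mem_annulus_iff T α z).mp hz).2.trans hle)
  have := (Real.le_sqrt (norm_nonneg _) hm).mp this
  rw [norm_sub_ofReal_sq] at this
  linarith

/-! ### Separation and the point at infinity -/

lemma mem_closure_profile {T : H →ₗ.[ℂ] H} {z : ℂ}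
    (hz : ∀ α : ℝ, (z : OnePoint ℂ) ∈ annulus T α) :
    (z.re, ‖z‖ ^ 2) ∈ closure (profile T) := by
  have hne : (profile T).Nonempty := by
    by_contra h
    rw [Set.not_nonempty_iff_eq_empty] at h
    have := le_of_mem_annulus (m := ‖z‖ ^ 2 + 1) (hz 0) (by simp [h])
    linarith
  by_contra hcl
  obtain ⟨f, c, hf, hfz⟩ := geometric_hahn_banach_closed_point (convex_profile T).closure
    isClosed_closure hcl
  set a := f (1, 0)
  set b := f (0, 1)
  have hfe (x w : ℝ) : f (x, w) = a * x + b * w := by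
    have : ((x, w) : ℝ × ℝ) = x • (1, 0) + w • (0, 1) := by simp
    rw [this, map_add, map_smul, map_smul, smul_eq_mul, smul_eq_mul]
    ring
  have hW : ∀ p ∈ profile T, a * p.1 + b * p.2 < c := fun p hp => by
    rw [← hfe]; exact hf p (subset_closure hp)
  rw [hfe] at hfz
  rcases lt_trichotomy b 0 with hb | hb | hb
  · have h := le_of_mem_annulus (m := c / b) (hz (-a / (2 * b))) fun p hp => by
      rw [div_le_iff_of_neg hb]
      have : (p.2 - 2 * (-a / (2 * b)) * p.1) * b = a * p.1 + b * p.2 := by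
        field_simp [hb.ne]; ring
      rw [this]
      exact (hW p hp).le
    rw [div_le_iff_of_neg hb] at h
    have : (‖z‖ ^ 2 - 2 * (-a / (2 * b)) * z.re) * b = a * z.re + b * ‖z‖ ^ 2 := by
      field_simp [hb.ne]; ring
    linarith
  · -- The separating line is vertical. Since `w ≥ 0` on the profile, the tilted bound
    -- `w - t a x ≥ -t c` holds there for every `t ≥ 0`, and it fails at `z` once `t` is large.
    rw [hb] at hW hfz
    simp only [zero_mul, add_zero] at hW hfz
    have hpos : 0 < a * z.re - c := by linarith
    set t := (‖z‖ ^ 2 + 1) / (a * z.re - c) with ht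
    have ht0 : 0 < t := by positivity
    have h := le_of_mem_annulus (m := -(t * c)) (hz (t * a / 2)) fun p hp => by
      have := sq_fst_le_snd hp
      nlinarith [mul_le_mul_of_nonneg_left (hW p hp).le ht0.le, sq_nonneg p.1]
    have : t * (a * z.re - c) = ‖z‖ ^ 2 + 1 := div_mul_cancel₀ _ hpos.ne'
    nlinarith
  · have h := le_of_mem_annulus' (m := c / b) (hz (-a / (2 * b))) hne fun p hp => by
      rw [le_div_iff₀ hb]
      have : (p.2 - 2 * (-a / (2 * b)) * p.1) * b = a * p.1 + b * p.2 := by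
        field_simp; ring
      rw [this]
      exact (hW p hp).le
    rw [le_div_iff₀ hb] at h
    have : (‖z‖ ^ 2 - 2 * (-a / (2 * b)) * z.re) * b = a * z.re + b * ‖z‖ ^ 2 := by
      field_simp; ring
    linarith

/-- If `∞` is not a limit of the scaled relative graph, then that set, and hence `T`, is bounded. -/
lemma infty_mem_closure_srg {T : H →ₗ.[ℂ] H} (h : OnePoint.infty ∈ annulus T 0) :
    OnePoint.infty ∈ closure (srg T) := by
  by_contra hcl
  have hK := ((OnePoint.isClosed_iff_of_notMem hcl).mp isClosed_closure).2
  obtain ⟨R, hR⟩ := hK.isBounded.exists_norm_le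
  have hle : maxGain (subScalar T 0) ≤ ENNReal.ofReal R := by
    refine iSup₂_le fun u hu => ENNReal.ofReal_le_ofReal ?_
    have hg : ‖subScalar T 0 u‖ = ‖T u‖ := by
      have e : subScalar T 0 u = T u - ((0 : ℝ) : ℂ) • (u : H) := rfl
      simp [e]
    rw [hg]
    have := hR _ (subset_closure (s := srg T) ⟨u, hu, Or.inl rfl⟩)
    refine le_trans (le_of_eq ?_) this
    rw [mul_comm Complex.I, norm_mul, Complex.norm_exp_ofReal_mul_I, mul_one, Complex.norm_real,
      Real.norm_of_nonneg (by positivity)]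
  rw [(infty_mem_annulus_iff T 0).mp h] at hle
  exact ENNReal.ofReal_ne_top (top_le_iff.mp hle)

end ScaledRelativeGraph

theorem corollary1 {H : Type*} [NormedAddCommGroup H] [InnerProductSpace ℂ H] [CompleteSpace H]
    (T : H →ₗ.[ℂ] H) (hT : T.IsClosed) :
    closure (ScaledRelativeGraph.srg T) = ⋂ α : ℝ, ScaledRelativeGraph.annulus T α := by
  refine Set.Subset.antisymm ?_ ?_
  · exact Set.subset_iInter fun α => closure_minimal
      (ScaledRelativeGraph.srg_subset_annulus T α) (ScaledRelativeGraph.isClosed_annulus T α)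
  · intro w hw
    rw [Set.mem_iInter] at hw
    induction w with
    | infty => exact ScaledRelativeGraph.infty_mem_closure_srg (hw 0)
    | coe z =>
      exact ScaledRelativeGraph.coe_mem_closure_srg (ScaledRelativeGraph.mem_closure_profile hw)
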